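/- Write $2^{<\omega}$ for the set of finite binary strings, $2^\omega$ for the set of infinite binary sequences, $[\![\sigma]\!]$ for the set of all $x\in2^\omega$ extending the string $\sigma$, and $x{\upharpoonright}n$ for the initial segment of $x$ of length $n$. For $p\in[0,1]$ let $\mu_p$ be the Bernoulli $p$-measure on $2^\omega$, $\mu_p(\sigma):=\mu_p([\![\sigma]\!])=p^{\#_0(\sigma)}(1-p)^{\#_1(\sigma)}$, where $\#_i(\sigma)$ is the number of occurrences of the bit $i$ in $\sigma$. As an oracle, $p$ is given by its binary expansion. Let $\mathsf{MLR}_{\mu_p}$ be the set of Bernoulli $p$-random sequences, i.e. of those $x\in2^\omega$ such that $x\notin\bigcap_i\mathcal U_i$ for every sequence $(\mathcal U_i)_{i\in\omega}$ of subsets of $2^\omega$ that is uniformly $\Sigma^0_1$ relative to $p$ and satisfies $\mu_p(\mathcal U_i)\le2^{-i}$ for all $i$. A semimeasure is a function $\delta:2^{<\omega}\to[0,1]$ with $\delta(\sigma)\ge\delta(\sigma0)+\delta(\sigma1)$ for all $\sigma\in2^{<\omega}$; it is left-c.e. if, uniformly in $\sigma$, $\delta(\sigma)$ is the limit of a computable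 nondecreasing sequence of rational numbers. A blind $p$-supermartingale is a function on $2^{<\omega}$ of the form $M=\delta/\mu_p$ with $\delta$ a left-c.e. semimeasure (no oracle), and $M$ succeeds on $x\in2^\omega$ if $\limsup_{n}M(x{\upharpoonright}n)=\infty$. **Theorem.** Let $p\in[0,1]$ satisfy $p\ge_T\emptyset'$, where $\emptyset'$ is the halting problem. Then there is some $y\in2^\omega$ with $y\notin\mathsf{MLR}_{\mu_p}$ such that no blind $p$-supermartingale succeeds on $y$. -/

import Mathlib

open MeasureTheory Filter Topology
open scoped ENNReal

namespace BlindBernoulli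

/-! Finite binary strings are `List Bool` and infinite binary sequences are `ℕ → Bool`
(product topology, Borel = product σ-algebra); `false` is the bit 0 and `true` is the bit 1. -/

/-- The initial segment of `x` of length `n`. -/
def restrict (x : ℕ → Bool) (n : ℕ) : List Bool := (List.range n).map x

/-- The basic clopen set of all sequences that extend the string `σ`. -/
def cylinder (σ : List Bool) : Set (ℕ → Bool) := {x | restrict x σ.length = σ}

/-! ### Computability -/

/-- A sequence, seen as a (total) number-theoretic function that can serve as an oracle. -/
def toOracle (z : ℕ → Bool) : ℕ →. ℕ := fun n => Part.some (z n).toNat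

/-- `S` is computably enumerable relative to `z`: it is the domain of a partial `z`-computable
function. -/
def CEIn {α : Type*} [Primcodable α] (z : ℕ → Bool) (S : Set α) : Prop :=
  ∃ f : α →. Unit, RecursiveIn {toOracle z} f ∧ ∀ a, a ∈ S ↔ (f a).Dom

open Classical in
/-- The (characteristic function of the) halting problem: the set of all `e` such that the
`e`-th partial computable function halts on input `e`. -/
noncomputable def emptyJump : ℕ → Bool :=
  fun e => decide ((Nat.Partrec.Code.eval (Denumerable.ofNat Nat.Partrec.Code e) e).Dom)

/-- The binary expansion of the fractional part of `p ≥ 0` (the one with infinitely many zeros).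
As an oracle it represents `p`; in particular `0` and `1` are represented by the computable
sequence of zeros. -/
noncomputable def binaryExpansion (p : ℝ) : ℕ → Bool :=
  fun n => decide (⌊p * 2 ^ (n + 1)⌋₊ % 2 = 1)

/-! ### Bernoulli measures and Martin-Löf randomness -/

/-- The Bernoulli `p`-measure on infinite binary sequences: the bits are independent, and each
of them is 0 with probability `p` and 1 with probability `1 - p`. -/
noncomputable def bernoulli (p : unitInterval) : Measure (ℕ → Bool) :=
  Measure.infinitePi fun _ => ProbabilityTheory.bernoulliMeasure false true p

theorem cylinder_eq_pi (σ : List Bool) : cylinder σ = Set.pi (Finset.range σ.length) (fun i => {σ.getD i false}) := by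
  ext x
  simp only [cylinder, restrict, Set.mem_ofPred_eq, Set.mem_pi, Finset.coe_range, Set.mem_Iio, Set.mem_singleton_iff]
  constructor
  · intro h i hi
    have := congrArg (fun l => l.getD i false) h
    simpa [hi] using this
  · intro h
    apply List.ext_getElem
    · simp
    · intro i h1 h2
      have := h i h2
      simpa [h2] using this

/-- The defining formula `μ_p σ = p ^ #₀(σ) * (1 - p) ^ #₁(σ)` of the Bernoulli measure. -/
theorem bernoulli_real_cylinder (p : unitInterval) (σ : List Bool) :
    (bernoulli p).real (cylinder σ) = (p:ℝ) ^ σ.count false * (1 - p) ^ σ.count true := by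
  rw [cylinder_eq_pi, bernoulli, Measure.real, Measure.infinitePi_pi _ (fun _ _ => MeasurableSet.singleton _), ENNReal.toReal_prod]
  have key : ∀ b, ((ProbabilityTheory.bernoulliMeasure false true p) {b}).toReal = if b then 1 - (p:ℝ) else p := by
    intro b
    cases b <;> simp [ProbabilityTheory.bernoulliMeasure_def]
  simp only [key]
  clear key
  induction σ with
  | nil => simp
  | cons b σ ih =>
    rw [List.length_cons, Finset.prod_range_succ']
    simp only [List.getD_cons_succ, List.getD_cons_zero] at ih ⊢
    rw [ih]
    cases b <;> simp [pow_succ] <;> ring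

/-- `U` is a `μ`-Martin-Löf test relative to `z`: a uniformly `Σ⁰₁` in `z` sequence of classes
with `μ (U i) ≤ 2⁻ⁱ`. -/
structure IsMLTest (μ : Measure (ℕ → Bool)) (z : ℕ → Bool) (U : ℕ → Set (ℕ → Bool)) : Prop where
  uniform : ∃ W : Set (ℕ × List Bool), CEIn z W ∧
    ∀ i, U i = {x | ∃ σ, (i, σ) ∈ W ∧ x ∈ cylinder σ}
  measure_le : ∀ i, μ (U i) ≤ (2⁻¹ : ℝ≥0∞) ^ i

/-- The sequences that are `μ`-Martin-Löf random relative to `z`. -/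
def MLR (μ : Measure (ℕ → Bool)) (z : ℕ → Bool) : Set (ℕ → Bool) :=
  {x | ∀ U, IsMLTest μ z U → x ∉ ⋂ i, U i}

/-- The Bernoulli `p`-random sequences: `μ_p`-Martin-Löf random relative to the parameter `p`. -/
noncomputable def BernoulliRandom (p : unitInterval) : Set (ℕ → Bool) :=
  MLR (bernoulli p) (binaryExpansion p)

/-! ### Semimeasures and blind supermartingales -/

/-- `ρ` is a semimeasure on finite strings. -/
structure IsSemimeasure (ρ : List Bool → ℝ) : Prop where
  mem_Icc : ∀ σ, ρ σ ∈ Set.Icc (0 : ℝ) 1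
  superadditive : ∀ σ, ρ (σ ++ [false]) + ρ (σ ++ [true]) ≤ ρ σ

/-- The nonnegative function `f` is left-c.e. uniformly in its argument: it is the pointwise limit
of a uniformly computable, nondecreasing sequence of rationals `num / (den + 1)`. (As `f` is
nonnegative, negative rationals in such a sequence can be replaced by 0.) -/
def IsLeftCE (f : List Bool → ℝ) : Prop :=
  ∃ num den : List Bool → ℕ → ℕ, Computable₂ num ∧ Computable₂ den ∧
    ∀ σ, Monotone (fun s => (num σ s : ℝ) / ((den σ s : ℝ) + 1)) ∧
      Tendsto (fun s => (num σ s : ℝ) / ((den σ s : ℝ) + 1)) atTop (𝓝 (f σ))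

/-- `M` is a blind `p`-supermartingale: the quotient `δ / μ_p` for a left-c.e. semimeasure `δ`,
where `μ_p σ` is the measure of the cylinder of `σ` (which is positive if `0 < p < 1`). -/
def IsBlindSupermartingale (p : unitInterval) (M : List Bool → ℝ) : Prop :=
  ∃ δ : List Bool → ℝ, IsSemimeasure δ ∧ IsLeftCE δ ∧
    ∀ σ, M σ = δ σ / (bernoulli p).real (cylinder σ)

/-- `M` succeeds on `x`: the limit superior of `M` along the initial segments of `x` is `∞`. -/
def Succeeds (M : List Bool → ℝ) (x : ℕ → Bool) : Prop :=
  limsup (fun n => (M (restrict x n) : EReal)) atTop = ⊤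

end BlindBernoulli

/-! ### Closure properties of functions computable relative to an oracle -/

section OracleComputability

open Encodable

/-! The sequence `y` is computed from `p`. As `p` computes the halting problem, which is not
computable, `p` is neither 0 nor 1. Cylinders along a `p`-computable sequence therefore shrink
exponentially and form a Martin-Löf test relative to `p` (`not_mem_MLR_of_computableIn`).

Since a blind supermartingale is `δ / μ_p` with `δ` left-c.e. without an oracle, the halting problem
gives `δ σ` to precision `2 ^ (-L * |σ|)`, by counting the members of a c.e. set
(`exists_approx_eq`). The construction runs through all c.e. sets and sets a candidate to zero above
any string where it visibly fails to be a semimeasure (`trim`). Up to rounding, `total` is `2 ^ (2 *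
L * |σ|)` times the sum of `2 ^ (-L * e) * δ_e σ` over `e < |σ|`, and `y` always moves to the child
where this sum is smaller relative to `μ_p`.

With exact data and no new candidates the quotient by `μ_p` would never increase. Three errors
occur: rounding, the entry of one new candidate per level, and the finite precision of `p`. Choosing
`L` with `2 / 2 ^ L ≤ min p (1 - p)` makes `μ_p` decay slowly enough that the additive errors at
level `n` are at most `4 * 2 ^ (-n)` and the multiplicative one at most `1 + 2 ^ (-n)`. Both are
summable, so the quotient stays bounded (`exists_total_path_le`), and so does each single `δ / μ_p`
along `y` (`div_cylinder_le_total`). -/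

theorem Nat.RecursiveIn.prec_at {O : Set (ℕ →. ℕ)} {f g h : ℕ →. ℕ} (hf : Nat.RecursiveIn O f)
    (hg : Nat.RecursiveIn O g) (hh : Nat.RecursiveIn O h) :
    Nat.RecursiveIn O fun a => (f a).bind fun n => n.rec (g a) fun y IH =>
      IH.bind fun i => h (Nat.pair a (Nat.pair y i)) :=
  ((Nat.RecursiveIn.prec hg hh).comp
    (Nat.RecursiveIn.pair (Nat.Partrec.recursiveIn Partrec.some) hf)).of_eq fun a =>
    Part.ext fun s => by simp [Seq.seq]

variable {α β γ σ : Type*} [Primcodable α] [Primcodable β] [Primcodable γ] [Primcodable σ]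
  {O : Set (ℕ →. ℕ)}

theorem RecursiveIn.comp {f : β →. σ} {g : α → β} (hf : RecursiveIn O f) (hg : ComputableIn O g) :
    RecursiveIn O fun a => f (g a) :=
  (Nat.RecursiveIn.comp hf hg).of_eq fun n => by
    simp only [Part.bind_eq_bind]
    rcases e : decode (α := α) n with - | a <;> simp [encodek]

namespace ComputableIn

theorem comp {f : β → σ} {g : α → β} (hf : ComputableIn O f) (hg : ComputableIn O g) :
    ComputableIn O fun a => f (g a) :=
  RecursiveIn.comp (f := fun b => Part.some (f b)) hf hg

theorem of_eq {f g : α → σ} (hf : ComputableIn O f) (H : ∀ n, f n = g n) : ComputableIn O g :=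
  (funext H : f = g) ▸ hf

theorem pair {f : α → β} {g : α → γ} (hf : ComputableIn O f) (hg : ComputableIn O g) :
    ComputableIn O fun a => (f a, g a) :=
  (Nat.RecursiveIn.pair hf hg).of_eq fun n => by
    rcases e : decode (α := α) n with - | a <;> simp [Seq.seq]

theorem comp₂ {f : β → γ → σ} {g : α → β} {h : α → γ} (hf : ComputableIn₂ O f)
    (hg : ComputableIn O g) (hh : ComputableIn O h) : ComputableIn O fun a => f (g a) (h a) :=
  ComputableIn.comp (f := fun q : β × γ => f q.1 q.2) hf (hg.pair hh)

theorem nat_rec {f : α → ℕ} {g : α → σ} {h : α → ℕ × σ → σ} (hf : ComputableIn O f)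
    (hg : ComputableIn O g) (hh : ComputableIn₂ O h) :
    ComputableIn O fun a => Nat.rec (motive := fun _ => σ) (g a) (fun y IH => h a (y, IH)) (f a) :=
  (Nat.RecursiveIn.prec_at hf hg hh).of_eq fun n => by
    rcases e : decode (α := α) n with - | a
    · simp
    · simp only [Part.coe_some, Part.bind_some, Part.map_some, encode_nat]
      induction f a with
      | zero => simp
      | succ m ih =>
        simp only [ih, Part.bind_some]
        simp [e, encodek]

theorem cond {c : α → Bool} {f g : α → σ} (hc : ComputableIn O c) (hf : ComputableIn O f)
    (hg : ComputableIn O g) : ComputableIn O fun a => bif c a then f a else g a :=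
  (nat_rec (f := fun a => (c a).toNat) (h := fun a _ => f a)
    ((Primrec.dom_finite Bool.toNat).computableIn.comp hc) hg
    (hf.comp ComputableIn.fst)).of_eq fun a => by cases c a <;> rfl

theorem ite {c : α → Prop} [DecidablePred c] {f g : α → σ}
    (hc : ComputableIn O fun a => decide (c a)) (hf : ComputableIn O f) (hg : ComputableIn O g) :
    ComputableIn O fun a => if c a then f a else g a :=
  (cond hc hf hg).of_eq fun a => by by_cases h : c a <;> simp [h]

theorem nat_add {f g : α → ℕ} (hf : ComputableIn O f) (hg : ComputableIn O g) :
    ComputableIn O fun a => f a + g a :=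
  comp₂ Primrec.nat_add.computableIn₂ hf hg

theorem nat_sub {f g : α → ℕ} (hf : ComputableIn O f) (hg : ComputableIn O g) :
    ComputableIn O fun a => f a - g a :=
  comp₂ Primrec.nat_sub.computableIn₂ hf hg

theorem nat_mul {f g : α → ℕ} (hf : ComputableIn O f) (hg : ComputableIn O g) :
    ComputableIn O fun a => f a * g a :=
  comp₂ Primrec.nat_mul.computableIn₂ hf hg

theorem two_pow {f : α → ℕ} (hf : ComputableIn O f) : ComputableIn O fun a => 2 ^ f a :=
  (nat_rec (h := fun _ q => q.2 * 2) hf (ComputableIn.const 1)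
    (nat_mul (ComputableIn.snd.comp ComputableIn.snd) (ComputableIn.const 2))).of_eq fun a => by
    induction f a with
    | zero => rfl
    | succ n ih => rw [pow_succ, ← ih]

theorem decide_le {f g : α → ℕ} (hf : ComputableIn O f) (hg : ComputableIn O g) :
    ComputableIn O fun a => decide (f a ≤ g a) :=
  comp₂ (f := fun a b : ℕ => decide (a ≤ b)) Primrec.nat_le.decide.computableIn₂ hf hg

theorem decide_eq {f g : α → β} [DecidableEq β] (hf : ComputableIn O f) (hg : ComputableIn O g) :
    ComputableIn O fun a => decide (f a = g a) :=
  comp₂ (f := fun a b : β => decide (a = b)) Primrec.eq.decide.computableIn₂ hf hg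

theorem sum_range {f : α → ℕ} {g : α → ℕ → ℕ} (hf : ComputableIn O f) (hg : ComputableIn₂ O g) :
    ComputableIn O fun a => ∑ i ∈ Finset.range (f a), g a i :=
  (nat_rec (h := fun a q => q.2 + g a q.1) hf (ComputableIn.const 0)
    (nat_add (ComputableIn.snd.comp ComputableIn.snd)
      (comp₂ hg ComputableIn.fst (ComputableIn.fst.comp ComputableIn.snd)))).of_eq fun a => by
    induction f a with
    | zero => rfl
    | succ n ih => rw [Finset.sum_range_succ, ← ih]

end ComputableIn

end OracleComputability

/-! ### The halting problem as an oracle, and nontriviality of `p` -/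

namespace BlindBernoulli

open Nat.Partrec (Code)
open Encodable

theorem computableIn_toOracle (z : ℕ → Bool) : ComputableIn {toOracle z} z :=
  have h : ComputableIn {toOracle z} fun n => (z n).toNat :=
    RecursiveIn.oracle (toOracle z) (Set.mem_singleton _)
  (ComputableIn.decide_eq h (ComputableIn.const 1)).of_eq fun n => by cases z n <;> rfl

theorem computableIn_of_toOracle {O : Set (ℕ →. ℕ)} {z : ℕ → Bool} (h : RecursiveIn O (toOracle z)) :
    ComputableIn O z :=
  (computableIn_toOracle z).subst (by rintro g rfl; exact h)

/-- The `e`-th computably enumerable set, decided with the help of the halting problem. -/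
noncomputable def halts (e x : ℕ) : Bool :=
  emptyJump (encode (Code.comp (Denumerable.ofNat Code e) (Code.const x)))

/-- Composing with a constant function makes the input irrelevant, so the diagonal halting problem
answers halting questions for every input. -/
theorem halts_iff (e x : ℕ) : halts e x = true ↔ (Code.eval (Denumerable.ofNat Code e) x).Dom := by
  simp only [halts, emptyJump, Denumerable.ofNat_encode, Code.eval, decide_eq_true_eq,
    Code.eval_const]
  exact Iff.of_eq (congrArg Part.Dom (Part.bind_some x (Code.eval (Denumerable.ofNat Code e))))

theorem computableIn_halts {O : Set (ℕ →. ℕ)} (h : ComputableIn O emptyJump) :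
    ComputableIn₂ O halts :=
  h.comp (g := fun q : ℕ × ℕ => encode (Code.comp (Denumerable.ofNat Code q.1) (Code.const q.2)))
    (Primrec.encode.comp (Code.primrec₂_comp.comp ((Primrec.ofNat Code).comp Primrec.fst)
      (Code.primrec_const.comp Primrec.snd))).computableIn

theorem not_computable_emptyJump : ¬ Computable emptyJump := by
  intro h
  have hc : Computable₂ halts := by
    have := computableIn_halts (O := {}) (recursiveIn_empty_iff.2 h)
    exact recursiveIn_empty_iff.1 this
  refine ComputablePred.halting_problem 0 (ComputablePred.computable_iff.2
    ⟨fun c => halts (encode c) 0, hc.comp Computable.encode (Computable.const 0), ?_⟩)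
  ext c
  simp [halts_iff, Denumerable.ofNat_encode]

theorem binaryExpansion_natCast (m : ℕ) : binaryExpansion m = fun _ => false := by
  funext n
  have : ((m : ℝ) * 2 ^ (n + 1)) = ((m * 2 ^ n * 2 : ℕ) : ℝ) := by push_cast; ring
  rw [binaryExpansion, this, Nat.floor_natCast]
  simp

/-- The endpoints are represented by the zero sequence, which cannot compute the halting problem. -/
theorem mem_Ioo_of_emptyJump_le {p : unitInterval}
    (hp : TuringReducible (toOracle emptyJump) (toOracle (binaryExpansion p))) :
    (p : ℝ) ∈ Set.Ioo (0 : ℝ) 1 := by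
  have key : ∀ m : ℕ, (p : ℝ) ≠ m := by
    intro m hm
    rw [hm, binaryExpansion_natCast] at hp
    exact not_computable_emptyJump
      (RecursiveIn.partrec_of_const (s := 0) (computableIn_of_toOracle hp))
  have h0 := key 0
  have h1 := key 1
  push_cast at h0 h1
  exact ⟨lt_of_le_of_ne p.2.1 (Ne.symm h0), lt_of_le_of_ne p.2.2 h1⟩

/-! ### Bounds for the measure of cylinders, and nonrandomness of computable sequences -/

theorem restrict_succ (x : ℕ → Bool) (n : ℕ) : restrict x (n + 1) = restrict x n ++ [x n] := by
  simp [restrict, List.range_succ]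

@[simp] theorem length_restrict (x : ℕ → Bool) (n : ℕ) : (restrict x n).length = n := by
  simp [restrict]

theorem cylinder_real_append (p : unitInterval) (σ : List Bool) (b : Bool) :
    (bernoulli p).real (cylinder (σ ++ [b])) =
      (bernoulli p).real (cylinder σ) * (if b then 1 - (p : ℝ) else p) := by
  simp only [bernoulli_real_cylinder]
  cases b <;> simp [pow_succ] <;> ring

theorem cylinder_real_pos {p : unitInterval} (hp : (p : ℝ) ∈ Set.Ioo (0 : ℝ) 1) (σ : List Bool) :
    0 < (bernoulli p).real (cylinder σ) := by
  rw [bernoulli_real_cylinder]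
  have := hp.1
  have := sub_pos.2 hp.2
  positivity

theorem pow_le_cylinder_real {p : unitInterval} {m : ℝ} (hm : 0 ≤ m) (h0 : m ≤ p) (h1 : m ≤ 1 - p)
    (σ : List Bool) : m ^ σ.length ≤ (bernoulli p).real (cylinder σ) := by
  rw [bernoulli_real_cylinder, ← List.count_false_add_count_true σ, pow_add]
  have := hm.trans h0
  gcongr

theorem cylinder_real_le_pow {p : unitInterval} {r : ℝ} (h0 : (p : ℝ) ≤ r) (h1 : 1 - (p : ℝ) ≤ r)
    (σ : List Bool) : (bernoulli p).real (cylinder σ) ≤ r ^ σ.length := by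
  have := p.2.1
  have := sub_nonneg.2 p.2.2
  rw [bernoulli_real_cylinder, ← List.count_false_add_count_true σ, pow_add]
  have : 0 ≤ r := p.2.1.trans h0
  gcongr

instance (p : unitInterval) : IsProbabilityMeasure (bernoulli p) := by
  unfold bernoulli; infer_instance

/-- A sequence that is computable from the oracle is not random relative to the oracle. -/
theorem not_mem_MLR_of_computableIn {p : unitInterval} (hp : (p : ℝ) ∈ Set.Ioo (0 : ℝ) 1)
    {z y : ℕ → Bool} (hy : ComputableIn {toOracle z} (restrict y)) :
    y ∉ MLR (bernoulli p) z := by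
  intro h
  set r : ℝ := max (p : ℝ) (1 - p) with hr
  have hr0 : 0 ≤ r := hp.1.le.trans (le_max_left _ _)
  have hr1 : r < 1 := max_lt hp.2 (by linarith [hp.1])
  -- Each block of `K` further bits at least halves the measure, so the initial segment of length `K
  -- * i` gives the `i`-th level of the test.
  obtain ⟨K, hK⟩ := exists_pow_lt_of_lt_one (show (0 : ℝ) < 2⁻¹ by norm_num) hr1
  refine h (fun i => cylinder (restrict y (K * i))) ⟨⟨{q | q.2 = restrict y (K * q.1)}, ?_, ?_⟩, ?_⟩ ?_
  · refine ⟨fun q => if q.2 = restrict y (K * q.1) then Part.some () else Part.none, ?_, ?_⟩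
    · have hpart : Partrec fun b : Bool => (if b then Part.some () else Part.none : Part Unit) :=
        (Partrec.cond (c := fun b : Bool => b) Computable.id (Partrec.some.comp (Computable.const ()))
          Partrec.none).of_eq fun b => by cases b <;> rfl
      have hdec : ComputableIn {toOracle z}
          fun q : ℕ × List Bool => decide (q.2 = restrict y (K * q.1)) :=
        ComputableIn.decide_eq ComputableIn.snd
          (hy.comp (ComputableIn.nat_mul (ComputableIn.const K) ComputableIn.fst))
      exact (RecursiveIn.comp hpart.recursiveIn hdec).of_eq fun q => by simp
    · rintro ⟨i, σ⟩
      by_cases hσ : σ = restrict y (K * i) <;> simp [hσ]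
  · intro i
    ext x
    simp
  · intro i
    rw [← ENNReal.ofReal_toReal (measure_ne_top (bernoulli p) (cylinder (restrict y (K * i))))]
    have : (2⁻¹ : ℝ≥0∞) ^ i = ENNReal.ofReal ((2⁻¹ : ℝ) ^ i) := by
      rw [ENNReal.ofReal_pow (by norm_num), ENNReal.ofReal_inv_of_pos (by norm_num)]
      simp
    rw [this]
    refine ENNReal.ofReal_le_ofReal ((cylinder_real_le_pow (r := r) (le_max_left _ _)
      (le_max_right _ _) _).trans ?_)
    rw [length_restrict, pow_mul]
    gcongr
  · simp [cylinder]

/-! ### A path along which no approximated supermartingale grows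

`c e σ` approximates `2 ^ (L * |σ|) * δ σ` from above, where `δ` is the `e`-th semimeasure, and
`P N` approximates `2 ^ N * p` from below. -/

/-- Detects a violation of superadditivity at `τ`. -/
def violation (c : ℕ → List Bool → ℕ) (L e : ℕ) (τ : List Bool) : ℕ :=
  if c e (τ ++ [false]) + c e (τ ++ [true]) ≤ 2 ^ L * c e τ + 2 then 0 else 1

/-- The value `c e σ`, replaced by `0` once superadditivity has been violated. -/
def trim (c : ℕ → List Bool → ℕ) (L e : ℕ) (σ : List Bool) : ℕ :=
  if ∑ i ∈ Finset.range σ.length, violation c L e (σ.take i) = 0 then c e σ else 0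

/-- The weighted sum of the trimmed values at `σ`. -/
def total (c : ℕ → List Bool → ℕ) (L : ℕ) (σ : List Bool) : ℕ :=
  ∑ e ∈ Finset.range σ.length, 2 ^ (L * (σ.length - e)) * trim c L e σ

/-- The bit that (nearly) minimises the weighted sum relative to the Bernoulli measure. -/
def nextBit (c : ℕ → List Bool → ℕ) (L : ℕ) (P : ℕ → ℕ) (σ : List Bool) : Bool :=
  !decide (total c L (σ ++ [false]) * (2 ^ (L * (σ.length + 1)) - P (L * (σ.length + 1))) ≤
    total c L (σ ++ [true]) * P (L * (σ.length + 1)))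

/-- The initial segments of the sequence that always follows `nextBit`. -/
def path (c : ℕ → List Bool → ℕ) (L : ℕ) (P : ℕ → ℕ) : ℕ → List Bool
  | 0 => []
  | n + 1 => path c L P n ++ [nextBit c L P (path c L P n)]

variable {c : ℕ → List Bool → ℕ} {L : ℕ} {P : ℕ → ℕ}

@[simp] theorem length_path (n : ℕ) : (path c L P n).length = n := by
  induction n with
  | zero => rfl
  | succ n ih => simp [path, ih]

theorem restrict_nextBit_path (n : ℕ) :
    restrict (fun n => nextBit c L P (path c L P n)) n = path c L P n := by
  induction n with
  | zero => rfl
  | succ n ih => rw [restrict_succ, ih, path]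

theorem sum_violation_append (e : ℕ) (σ : List Bool) (b : Bool) :
    ∑ i ∈ Finset.range (σ ++ [b]).length, violation c L e ((σ ++ [b]).take i) =
      ∑ i ∈ Finset.range σ.length, violation c L e (σ.take i) + violation c L e σ := by
  rw [List.length_append, List.length_singleton, Finset.sum_range_succ]
  congr 1
  · refine Finset.sum_congr rfl fun i hi => ?_
    rw [List.take_append_of_le_length (Finset.mem_range.1 hi).le]
  · simp

theorem trim_le (e : ℕ) (σ : List Bool) : trim c L e σ ≤ c e σ := by
  unfold trim; split_ifs <;> simp

/-- Trimming at a string looks only at proper prefixes, so a violation at `σ` kills the children of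
`σ`. The inequality therefore holds for arbitrary `c`. -/
theorem trim_add_le (e : ℕ) (σ : List Bool) :
    trim c L e (σ ++ [false]) + trim c L e (σ ++ [true]) ≤ 2 ^ L * trim c L e σ + 2 := by
  simp only [trim, sum_violation_append, Nat.add_eq_zero_iff]
  split_ifs with h1 h2 h2
  · have := h1.2
    unfold violation at this
    split_ifs at this with h3
    exact h3
  · exact absurd h1.1 h2
  · simp
  · simp

/-- A geometric sum with ratio at least 2; the summand 2 on the left strengthens the claim so that
the induction closes. -/
theorem sum_two_pow_le (hL : 1 ≤ L) (n : ℕ) :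
    ∑ e ∈ Finset.range n, 2 ^ (L * (n - e)) + 2 ≤ 2 * 2 ^ (L * n) := by
  induction n with
  | zero => simp
  | succ n ih =>
    have h2 : 2 ≤ 2 ^ L := by simpa using Nat.pow_le_pow_right (n := 2) (by norm_num) hL
    have : ∑ e ∈ Finset.range n, 2 ^ (L * (n + 1 - e)) =
        2 ^ L * ∑ e ∈ Finset.range n, 2 ^ (L * (n - e)) := by
      rw [Finset.mul_sum]
      refine Finset.sum_congr rfl fun e he => ?_
      rw [← pow_add, Nat.succ_sub (Finset.mem_range.1 he).le, Nat.mul_succ, add_comm]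
    rw [Finset.sum_range_succ, this, Nat.add_sub_cancel_left, mul_one,
      show 2 * 2 ^ (L * (n + 1)) = 2 ^ L * (2 * 2 ^ (L * n)) by ring]
    nlinarith [Nat.mul_le_mul_left (2 ^ L) ih]

/-- The error has two halves of size `2 * 2 ^ (L * (n + 2))`, where `n` is the length of `σ`: one
for the rounding of the candidates `e < n`, the other for the candidate `e = n`, which enters at the
children. -/
theorem total_add_le (hL : 1 ≤ L) (hc : ∀ e σ, c e σ ≤ 2 ^ (L * σ.length)) (σ : List Bool) :
    total c L (σ ++ [false]) + total c L (σ ++ [true]) ≤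
      2 ^ (2 * L) * total c L σ + 4 * 2 ^ (L * (σ.length + 2)) := by
  set n := σ.length with hn
  have hlen : ∀ b, (σ ++ [b]).length = n + 1 := fun b => by simp [hn]
  have h2 : 2 ≤ 2 ^ L := by simpa using Nat.pow_le_pow_right (n := 2) (by norm_num) hL
  have hlast : ∀ b, trim c L n (σ ++ [b]) ≤ 2 ^ (L * (n + 1)) := fun b =>
    (trim_le _ _).trans ((hc _ _).trans_eq (by rw [hlen]))
  have hterm : ∀ e ∈ Finset.range n,
      2 ^ (L * (n + 1 - e)) * (trim c L e (σ ++ [false]) + trim c L e (σ ++ [true])) ≤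
      2 ^ (2 * L) * (2 ^ (L * (n - e)) * trim c L e σ) + 2 * 2 ^ L * 2 ^ (L * (n - e)) := by
    intro e he
    rw [Nat.succ_sub (Finset.mem_range.1 he).le, Nat.succ_eq_add_one]
    refine (Nat.mul_le_mul_left _ (trim_add_le e σ)).trans_eq ?_
    ring
  have hsum := Finset.sum_le_sum hterm
  rw [Finset.sum_add_distrib, ← Finset.mul_sum, ← Finset.mul_sum] at hsum
  have hgeo := sum_two_pow_le hL n
  have e1 : 2 ^ (L * (n + 2)) = 2 ^ L * (2 ^ L * 2 ^ (L * n)) := by ring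
  have e2 : 2 ^ (L * (n + 1)) = 2 ^ L * 2 ^ (L * n) := by ring
  have h3 := Nat.mul_le_mul_left (2 * 2 ^ L) hgeo
  have h4 := Nat.mul_le_mul_right (2 ^ L * 2 ^ (L * n)) h2
  have h5 := Nat.mul_le_mul_left (2 ^ L) (Nat.add_le_add (hlast false) (hlast true))
  rw [e2] at h5
  simp only [total, hlen]
  rw [← Finset.sum_add_distrib, Finset.sum_range_succ]
  simp only [← mul_add]
  rw [Nat.add_sub_cancel_left, mul_one, e1, ← hn]
  nlinarith

/-- One of the two children carries at most its `μ_p`-share of the sum. Bit 0 is chosen when its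
share is at most `P / 2 ^ N`, which is at most `p`, so it costs nothing. Bit 1 has share at most `1
- P / 2 ^ N`, which may exceed `1 - p` by `2 ^ (-N)`; the factor `1 + η` absorbs this. -/
theorem total_nextBit_le {p η : ℝ} (hp : p ∈ Set.Ioo (0 : ℝ) 1) (σ : List Bool) (hη : 0 ≤ η)
    (hP : P (L * (σ.length + 1)) = ⌊p * 2 ^ (L * (σ.length + 1))⌋₊)
    (hηL : 1 ≤ η * (1 - p) * 2 ^ (L * (σ.length + 1))) :
    (total c L (σ ++ [nextBit c L P σ]) : ℝ) ≤
      ((total c L (σ ++ [false]) : ℝ) + total c L (σ ++ [true])) *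
        ((if nextBit c L P σ then 1 - p else p) * (1 + η)) := by
  set N := L * (σ.length + 1) with hN
  have hT : (0 : ℝ) < 2 ^ N := by positivity
  have hle : (P N : ℝ) ≤ p * 2 ^ N := by
    rw [hP]; exact Nat.floor_le (mul_nonneg hp.1.le hT.le)
  have hlt : p * 2 ^ N < P N + 1 := by rw [hP]; exact Nat.lt_floor_add_one _
  have hPT : P N ≤ 2 ^ N := by
    have : (P N : ℝ) ≤ 2 ^ N := hle.trans (by nlinarith [hp.2])
    exact_mod_cast this
  have h0 : (0 : ℝ) ≤ total c L (σ ++ [false]) := by positivity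
  have h1 : (0 : ℝ) ≤ total c L (σ ++ [true]) := by positivity
  by_cases h : total c L (σ ++ [false]) * (2 ^ N - P N) ≤ total c L (σ ++ [true]) * P N
  · have hb : nextBit c L P σ = false := by simp only [nextBit, ← hN, h]; rfl
    rw [hb]
    have h' : (total c L (σ ++ [false]) : ℝ) * (2 ^ N - P N) ≤ total c L (σ ++ [true]) * P N := by
      have := h; rw [← Nat.cast_le (α := ℝ)] at this
      push_cast [Nat.cast_sub hPT] at this
      exact this
    have : (total c L (σ ++ [false]) : ℝ) ≤
        ((total c L (σ ++ [false]) : ℝ) + total c L (σ ++ [true])) * p := by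
      refine le_of_mul_le_mul_right ?_ hT
      nlinarith
    have h3 := mul_nonneg (mul_nonneg (add_nonneg h0 h1) hp.1.le) hη
    simp only [Bool.false_eq_true, if_false]
    linarith
  · have hb : nextBit c L P σ = true := by simp only [nextBit, ← hN, h]; rfl
    rw [hb]
    have h' : (total c L (σ ++ [true]) : ℝ) * P N ≤ total c L (σ ++ [false]) * (2 ^ N - P N) := by
      have := (not_le.1 h).le; rw [← Nat.cast_le (α := ℝ)] at this
      push_cast [Nat.cast_sub hPT] at this
      exact this
    simp only [if_true]
    refine le_of_mul_le_mul_right ?_ hT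
    have h3 : (2 : ℝ) ^ N - P N ≤ (1 - p) * (1 + η) * 2 ^ N := by linarith
    nlinarith [mul_le_mul_of_nonneg_left h3 (add_nonneg h0 h1)]

theorem exists_le_of_rec {X : ℕ → ℝ} (hX : ∀ n, 0 ≤ X n)
    (h : ∀ n, X (n + 1) ≤ (X n + 4 * (1 / 2) ^ n) * (1 + (1 / 2) ^ n)) : ∃ B, ∀ n, X n ≤ B := by
  -- The additive errors from stage `n` on sum to `8 * (1 / 2) ^ n` and are paid in advance; the
  -- exponent is the sum of `(1 / 2) ^ i` over `i < n`, which bounds the product of the factors.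
  have key : ∀ n, X n + 8 * (1 / 2) ^ n ≤ (X 0 + 8) * Real.exp (2 - 2 * (1 / 2) ^ n) := by
    intro n
    induction n with
    | zero => simp
    | succ n ih =>
      set t : ℝ := (1 / 2) ^ n with ht
      have ht0 : 0 ≤ t := by positivity
      have h1 : (1 / 2 : ℝ) ^ (n + 1) = t / 2 := by rw [pow_succ]; ring
      have h2 := h n
      have h3 : 1 + t ≤ Real.exp t := by linarith [Real.add_one_le_exp t]
      have h4 : X (n + 1) + 8 * (t / 2) ≤ (X n + 8 * t) * (1 + t) := by nlinarith
      rw [h1, show 2 - 2 * (t / 2) = (2 - 2 * t) + t by ring, Real.exp_add, ← mul_assoc]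
      refine h4.trans (mul_le_mul ih h3 (by positivity) ?_)
      have := hX 0
      positivity
  refine ⟨(X 0 + 8) * Real.exp 2, fun n => ?_⟩
  have h0 := hX 0
  have ht : (0 : ℝ) ≤ (1 / 2) ^ n := by positivity
  have : (X 0 + 8) * Real.exp (2 - 2 * (1 / 2) ^ n) ≤ (X 0 + 8) * Real.exp 2 := by
    gcongr; linarith
  linarith [key n]

theorem exists_total_path_le {p : unitInterval} (hp : (p : ℝ) ∈ Set.Ioo (0 : ℝ) 1)
    (h0 : 2 / 2 ^ L ≤ (p : ℝ)) (h1 : 2 / 2 ^ L ≤ 1 - (p : ℝ))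
    (hc : ∀ e σ, c e σ ≤ 2 ^ (L * σ.length)) (hP : ∀ N, P N = ⌊(p : ℝ) * 2 ^ N⌋₊) :
    ∃ B : ℝ, ∀ n, (total c L (path c L P n) : ℝ) /
      (2 ^ (2 * L * n) * (bernoulli p).real (cylinder (path c L P n))) ≤ B := by
  have hL : 1 ≤ L := by
    by_contra hL
    obtain rfl : L = 0 := by omega
    norm_num at h0
    linarith [hp.2]
  have h2 : (2 : ℝ) ≤ 2 ^ L := by
    simpa using pow_le_pow_right₀ (a := (2 : ℝ)) (by norm_num) hL
  have hT : (0 : ℝ) < 2 ^ L := by positivity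
  refine exists_le_of_rec (fun n => by positivity) fun n => ?_
  set σ := path c L P n with hσ
  have hlen : σ.length = n := length_path n
  have hμ := cylinder_real_pos hp σ
  set w : ℝ := if nextBit c L P σ then 1 - (p : ℝ) else p with hw
  have hw0 : 0 < w := by rw [hw]; split_ifs <;> linarith [hp.1, hp.2]
  have hμm : ((2 : ℝ) / 2 ^ L) ^ n ≤ (bernoulli p).real (cylinder σ) := by
    simpa [hlen] using pow_le_cylinder_real (by positivity) h0 h1 σ
  -- `P` is read to `L * (n + 1)` bits, enough for relative error `(1 / 2) ^ n` because `2 ^ L` is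
  -- at least 2 and `(1 - p) * 2 ^ L` is at least 2.
  have hη : 1 ≤ (1 / 2 : ℝ) ^ n * (1 - p) * 2 ^ (L * (σ.length + 1)) := by
    have e1 : (2 : ℝ) ^ (L * (σ.length + 1)) = (2 ^ L) ^ n * 2 ^ L := by
      rw [hlen, pow_mul, pow_succ]
    have e2 : (1 : ℝ) ≤ (1 / 2 * 2 ^ L) ^ n := one_le_pow₀ (by linarith)
    have e3 : 2 ≤ (1 - (p : ℝ)) * 2 ^ L := by rwa [div_le_iff₀ hT] at h1
    rw [e1, show (1 / 2 : ℝ) ^ n * (1 - p) * ((2 ^ L) ^ n * 2 ^ L) =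
      (1 / 2 * 2 ^ L) ^ n * ((1 - p) * 2 ^ L) by rw [mul_pow]; ring]
    nlinarith
  have hstep := total_nextBit_le (c := c) hp σ (η := (1 / 2) ^ n) (by positivity) (hP _) hη
  have hadd : (total c L (σ ++ [false]) : ℝ) + total c L (σ ++ [true]) ≤
      2 ^ (2 * L) * total c L σ + 4 * 2 ^ (L * (n + 2)) := by
    have := total_add_le hL hc σ
    rw [hlen] at this
    exact_mod_cast this
  rw [path, ← hσ, cylinder_real_append, ← hw]
  rw [← hw] at hstep
  set μ := (bernoulli p).real (cylinder σ)
  rw [div_le_iff₀ (by positivity)]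
  refine hstep.trans ?_
  -- The lower bound `(2 / 2 ^ L) ^ n ≤ μ` is what turns the absolute error into the summable
  -- relative error `4 * (1 / 2) ^ n`.
  have hpow : 4 * (2 : ℝ) ^ (L * (n + 2)) ≤ 4 * (1 / 2) ^ n * (2 ^ (2 * L * (n + 1)) * μ) := by
    have e1 : (1 / 2 : ℝ) ^ n * (2 / 2 ^ L) ^ n * 2 ^ (2 * L * (n + 1)) = 2 ^ (L * (n + 2)) := by
      rw [← mul_pow, show (1 / 2 : ℝ) * (2 / 2 ^ L) = 1 / 2 ^ L by ring, one_div, inv_pow, ← pow_mul,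
        show 2 * L * (n + 1) = L * n + L * (n + 2) by ring, pow_add (2 : ℝ) (L * n)]
      field_simp
    have e2 : (1 / 2 : ℝ) ^ n * (2 / 2 ^ L) ^ n * 2 ^ (2 * L * (n + 1)) ≤
        (1 / 2 : ℝ) ^ n * μ * 2 ^ (2 * L * (n + 1)) := by gcongr
    rw [e1] at e2
    linarith
  have hX : (2 : ℝ) ^ (2 * L) * total c L σ =
      (total c L σ : ℝ) / (2 ^ (2 * L * n) * μ) * (2 ^ (2 * L * (n + 1)) * μ) := by
    rw [mul_add, mul_one, pow_add]
    field_simp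
  have hfin : (total c L (σ ++ [false]) : ℝ) + total c L (σ ++ [true]) ≤
      ((total c L σ : ℝ) / (2 ^ (2 * L * n) * μ) + 4 * (1 / 2) ^ n) *
        (2 ^ (2 * L * (n + 1)) * μ) := by linarith
  have := mul_le_mul_of_nonneg_right hfin (show 0 ≤ w * (1 + (1 / 2) ^ n) by positivity)
  refine this.trans_eq ?_
  ring

/-- Each child is rounded up by less than 1, so a genuine semimeasure never exceeds the tolerance 2
in `violation` and is never trimmed. -/
theorem trim_eq_of_isSemimeasure {δ : List Bool → ℝ} (hδ : IsSemimeasure δ) {e : ℕ}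
    (hle : ∀ σ, 2 ^ (L * σ.length) * δ σ ≤ c e σ) (hlt : ∀ σ, (c e σ : ℝ) < 2 ^ (L * σ.length) * δ σ + 1)
    (σ : List Bool) : trim c L e σ = c e σ := by
  have : ∀ τ, violation c L e τ = 0 := by
    intro τ
    have h0 := hlt (τ ++ [false])
    have h1 := hlt (τ ++ [true])
    have h2 := mul_le_mul_of_nonneg_left (hδ.superadditive τ)
      (show (0 : ℝ) ≤ 2 ^ L * 2 ^ (L * τ.length) by positivity)
    have h3 := mul_le_mul_of_nonneg_left (hle τ) (show (0 : ℝ) ≤ 2 ^ L by positivity)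
    simp only [List.length_append, List.length_singleton] at h0 h1
    rw [show (2 : ℝ) ^ (L * (τ.length + 1)) = 2 ^ L * 2 ^ (L * τ.length) by ring] at h0 h1
    have : (c e (τ ++ [false]) : ℝ) + c e (τ ++ [true]) ≤ 2 ^ L * c e τ + 2 := by linarith
    exact if_pos (by exact_mod_cast this)
  simp [trim, this]

/-- The candidate `e` is a single summand of `total`, with relative weight `2 ^ (-L * e)`, so a
bound on the sum bounds it up to a constant. -/
theorem div_cylinder_le_total {δ : List Bool → ℝ} (hδ : IsSemimeasure δ) {e : ℕ}
    (hle : ∀ σ, 2 ^ (L * σ.length) * δ σ ≤ c e σ) (hlt : ∀ σ, (c e σ : ℝ) < 2 ^ (L * σ.length) * δ σ + 1)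
    {p : unitInterval} (hp : (p : ℝ) ∈ Set.Ioo (0 : ℝ) 1) {σ : List Bool} (hσ : e < σ.length) :
    δ σ / (bernoulli p).real (cylinder σ) ≤ 2 ^ (L * e) * ((total c L σ : ℝ) /
      (2 ^ (2 * L * σ.length) * (bernoulli p).real (cylinder σ))) := by
  have hμ := cylinder_real_pos hp σ
  have h1 : 2 ^ (L * (σ.length - e)) * c e σ ≤ total c L σ := by
    rw [← trim_eq_of_isSemimeasure hδ hle hlt σ]
    exact Finset.single_le_sum (f := fun e => 2 ^ (L * (σ.length - e)) * trim c L e σ)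
      (fun _ _ => Nat.zero_le _) (Finset.mem_range.2 hσ)
  have h2 : (2 : ℝ) ^ (L * (σ.length - e)) * c e σ ≤ total c L σ := by exact_mod_cast h1
  have h3 : (2 : ℝ) ^ (2 * L * σ.length) =
      2 ^ (L * e) * 2 ^ (L * (σ.length - e)) * 2 ^ (L * σ.length) := by
    rw [← pow_add, ← pow_add, ← mul_add, Nat.add_sub_cancel' hσ.le]
    ring_nf
  have h4 := (mul_le_mul_of_nonneg_left (hle σ)
    (show (0 : ℝ) ≤ 2 ^ (L * (σ.length - e)) by positivity)).trans h2
  rw [← mul_div_assoc, div_le_div_iff₀ hμ (by positivity), h3]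
  have := mul_le_mul_of_nonneg_left h4
    (show 0 ≤ 2 ^ (L * e) * (bernoulli p).real (cylinder σ) by positivity)
  linarith

/-! ### Computability of the path from the oracle -/

section Computability

variable {O : Set (ℕ →. ℕ)} {c : ℕ → List Bool → ℕ} {L : ℕ} {P : ℕ → ℕ}

theorem computableIn_append {α : Type*} [Primcodable α] {f g : α → List Bool}
    (hf : ComputableIn O f) (hg : ComputableIn O g) : ComputableIn O fun a => f a ++ g a :=
  ComputableIn.comp₂ Primrec.list_append.computableIn₂ hf hg

theorem computableIn_length {α : Type*} [Primcodable α] {f : α → List Bool}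
    (hf : ComputableIn O f) : ComputableIn O fun a => (f a).length :=
  Primrec.list_length.computableIn.comp hf

theorem computableIn_violation (hc : ComputableIn₂ O c) : ComputableIn₂ O (violation c L) := by
  have happ : ∀ b : Bool, ComputableIn O fun q : ℕ × List Bool => c q.1 (q.2 ++ [b]) := fun b =>
    ComputableIn.comp₂ hc ComputableIn.fst
      (computableIn_append ComputableIn.snd (ComputableIn.const [b]))
  exact ComputableIn.ite
    (ComputableIn.decide_le (ComputableIn.nat_add (happ false) (happ true))
      (ComputableIn.nat_add (ComputableIn.nat_mul (ComputableIn.const (2 ^ L)) hc)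
        (ComputableIn.const 2)))
    (ComputableIn.const 0) (ComputableIn.const 1)

theorem computableIn_trim (hc : ComputableIn₂ O c) : ComputableIn₂ O (trim c L) := by
  have htake : ComputableIn₂ O fun (i : ℕ) (σ : List Bool) => σ.take i :=
    Primrec.list_take.computableIn₂
  exact ComputableIn.ite
    (ComputableIn.decide_eq
      (ComputableIn.sum_range (g := fun (q : ℕ × List Bool) i => violation c L q.1 (q.2.take i))
        (computableIn_length ComputableIn.snd)
        (ComputableIn.comp₂ (computableIn_violation hc) (ComputableIn.fst.comp ComputableIn.fst)
          (ComputableIn.comp₂ htake ComputableIn.snd (ComputableIn.snd.comp ComputableIn.fst))))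
      (ComputableIn.const 0))
    hc (ComputableIn.const 0)

theorem computableIn_total (hc : ComputableIn₂ O c) : ComputableIn O (total c L) :=
  ComputableIn.sum_range (g := fun σ e => 2 ^ (L * (σ.length - e)) * trim c L e σ)
    (computableIn_length ComputableIn.id)
    (ComputableIn.nat_mul
      (ComputableIn.two_pow (ComputableIn.nat_mul (ComputableIn.const L)
        (ComputableIn.nat_sub (computableIn_length ComputableIn.fst) ComputableIn.snd)))
      (ComputableIn.comp₂ (computableIn_trim hc) ComputableIn.snd ComputableIn.fst))

theorem computableIn_nextBit (hc : ComputableIn₂ O c) (hP : ComputableIn O P) :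
    ComputableIn O (nextBit c L P) := by
  have hN : ComputableIn O fun σ : List Bool => L * (σ.length + 1) :=
    ComputableIn.nat_mul (ComputableIn.const L)
      (ComputableIn.nat_add (computableIn_length ComputableIn.id) (ComputableIn.const 1))
  have ht : ∀ b : Bool, ComputableIn O fun σ : List Bool => total c L (σ ++ [b]) := fun b =>
    (computableIn_total hc).comp (computableIn_append ComputableIn.id (ComputableIn.const [b]))
  exact Primrec.not.computableIn.comp (ComputableIn.decide_le
    (ComputableIn.nat_mul (ht false)
      (ComputableIn.nat_sub (ComputableIn.two_pow hN) (hP.comp hN)))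
    (ComputableIn.nat_mul (ht true) (hP.comp hN)))

theorem computableIn_path (hc : ComputableIn₂ O c) (hP : ComputableIn O P) :
    ComputableIn O (path c L P) := by
  have hlast : ComputableIn O fun q : ℕ × ℕ × List Bool => q.2.2 :=
    ComputableIn.snd.comp ComputableIn.snd
  have hsingle : ComputableIn O fun b : Bool => [b] :=
    (Primrec.list_cons.comp Primrec.id (Primrec.const [])).computableIn
  refine (ComputableIn.nat_rec (h := fun _ q => q.2 ++ [nextBit c L P q.2]) ComputableIn.id
    (ComputableIn.const []) (computableIn_append hlast
      (hsingle.comp ((computableIn_nextBit hc hP).comp hlast)))).of_eq fun n => ?_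
  induction n with
  | zero => rfl
  | succ n ih => rw [path, ← ih]; rfl

end Computability

/-! ### Approximations from the oracle -/

/-- The number formed by the first `N` bits of `z`. -/
def bitsValue (z : ℕ → Bool) (N : ℕ) : ℕ :=
  ∑ i ∈ Finset.range N, 2 ^ (N - 1 - i) * (z i).toNat

theorem computableIn_bitsValue {O : Set (ℕ →. ℕ)} {z : ℕ → Bool} (hz : ComputableIn O z) :
    ComputableIn O (bitsValue z) :=
  ComputableIn.sum_range (g := fun N i => 2 ^ (N - 1 - i) * (z i).toNat) ComputableIn.id
    (ComputableIn.nat_mul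
      (ComputableIn.two_pow (ComputableIn.nat_sub
        (ComputableIn.nat_sub ComputableIn.fst (ComputableIn.const 1)) ComputableIn.snd))
      ((Primrec.dom_finite Bool.toNat).computableIn.comp (hz.comp ComputableIn.snd)))

theorem bitsValue_succ (z : ℕ → Bool) (N : ℕ) :
    bitsValue z (N + 1) = 2 * bitsValue z N + (z N).toNat := by
  rw [bitsValue, Finset.sum_range_succ, bitsValue, Finset.mul_sum]
  congr 1
  · refine Finset.sum_congr rfl fun i hi => ?_
    have : N + 1 - 1 - i = (N - 1 - i) + 1 := by have := Finset.mem_range.1 hi; omega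
    rw [this, pow_succ]
    ring
  · simp

/-- Doubling the scale appends one bit to the floor. The induction starts from integer part 0, hence
`p < 1`. -/
theorem bitsValue_binaryExpansion {p : ℝ} (h1 : p < 1) (N : ℕ) :
    bitsValue (binaryExpansion p) N = ⌊p * 2 ^ N⌋₊ := by
  induction N with
  | zero => simpa [bitsValue] using (Nat.floor_eq_zero.2 h1).symm
  | succ N ih =>
    have hhalf : ⌊p * 2 ^ (N + 1)⌋₊ / 2 = ⌊p * 2 ^ N⌋₊ := by
      rw [← Nat.floor_div_ofNat]
      congr 1
      rw [pow_succ]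
      ring
    have hbit : (binaryExpansion p N).toNat = ⌊p * 2 ^ (N + 1)⌋₊ % 2 := by
      unfold binaryExpansion
      rcases Nat.mod_two_eq_zero_or_one ⌊p * 2 ^ (N + 1)⌋₊ with h | h <;> simp [h]
    rw [bitsValue_succ, ih, hbit, ← hhalf, Nat.div_add_mod]

/-- The number of `k < 2 ^ (L * |σ|)` such that `(σ, k)` is in the `e`-th c.e. set. -/
noncomputable def approx (L e : ℕ) (σ : List Bool) : ℕ :=
  ∑ k ∈ Finset.range (2 ^ (L * σ.length)), (halts e (encode (σ, k))).toNat

theorem approx_le (L e : ℕ) (σ : List Bool) : approx L e σ ≤ 2 ^ (L * σ.length) := by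
  refine (Finset.sum_le_card_nsmul _ _ 1 fun k _ => Bool.toNat_le _).trans_eq ?_
  simp

theorem computableIn_approx {O : Set (ℕ →. ℕ)} (h : ComputableIn O emptyJump) (L : ℕ) :
    ComputableIn₂ O (approx L) := by
  have hcode : ComputableIn O fun q : (ℕ × List Bool) × ℕ => encode (q.1.2, q.2) :=
    (Primrec.encode.comp ((Primrec.snd.comp Primrec.fst).pair Primrec.snd)).computableIn
  exact ComputableIn.sum_range
    (g := fun (q : ℕ × List Bool) k => (halts q.1 (encode (q.2, k))).toNat)
    (ComputableIn.two_pow (ComputableIn.nat_mul (ComputableIn.const L)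
      (computableIn_length ComputableIn.snd)))
    ((Primrec.dom_finite Bool.toNat).computableIn.comp (ComputableIn.comp₂ (computableIn_halts h)
      (ComputableIn.fst.comp ComputableIn.fst) hcode))

/-- The strict lower cut of a left-c.e. real is c.e.: search for a stage whose rational already
exceeds the bound. A limit of a nondecreasing sequence exceeds a number strictly exactly when some
term does. -/
theorem exists_halts_iff_lt {δ : List Bool → ℝ} (hδ : IsLeftCE δ) (L : ℕ) :
    ∃ e, ∀ σ (k : ℕ), halts e (encode (σ, k)) = true ↔ (k : ℝ) < 2 ^ (L * σ.length) * δ σ := by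
  obtain ⟨num, den, hnum, hden, h⟩ := hδ
  let t : List Bool × ℕ → ℕ → Bool := fun q s =>
    !decide (2 ^ (L * q.1.length) * num q.1 s ≤ q.2 * (den q.1 s + 1))
  have ht : Computable₂ t := by
    have hn : ∀ {f : List Bool → ℕ → ℕ}, Computable₂ f →
        ComputableIn {} fun q : (List Bool × ℕ) × ℕ => f q.1.1 q.2 := fun hf =>
      ComputableIn.comp₂ (recursiveIn_empty_iff.2 hf) (ComputableIn.fst.comp ComputableIn.fst)
        ComputableIn.snd
    exact recursiveIn_empty_iff.1 (Primrec.not.computableIn.comp (ComputableIn.decide_le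
      (ComputableIn.nat_mul (ComputableIn.two_pow (ComputableIn.nat_mul (ComputableIn.const L)
        (computableIn_length (ComputableIn.fst.comp ComputableIn.fst)))) (hn hnum))
      (ComputableIn.nat_mul (ComputableIn.snd.comp ComputableIn.fst)
        (ComputableIn.nat_add (hn hden) (ComputableIn.const 1)))))
  have hf : Partrec fun q => Nat.rfind fun s => Part.some (t q s) := Partrec.rfind ht.partrec₂
  obtain ⟨code, hcode⟩ := Code.exists_code.1 hf
  refine ⟨encode code, fun σ k => ?_⟩
  have hpos : (0 : ℝ) < 2 ^ (L * σ.length) := by positivity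
  have hts : ∀ s, t (σ, k) s = true ↔
      (k : ℝ) / 2 ^ (L * σ.length) < (num σ s : ℝ) / ((den σ s : ℝ) + 1) := by
    intro s
    rw [div_lt_div_iff₀ hpos (by positivity)]
    simp only [t, Bool.not_eq_true', decide_eq_false_iff_not, not_le, mul_comm (2 ^ _)]
    exact_mod_cast Iff.rfl
  rw [halts_iff, Denumerable.ofNat_encode, hcode]
  simp only [encodek, Part.coe_some, Part.bind_some, Part.map_Dom]
  refine Nat.rfind_dom'.trans ?_
  rw [mul_comm, ← div_lt_iff₀ hpos]
  constructor
  · rintro ⟨s, hs, -⟩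
    exact ((hts s).1 (Part.mem_some_iff.1 hs).symm).trans_le ((h σ).1.ge_of_tendsto (h σ).2 s)
  · intro hlt
    obtain ⟨s, hs⟩ := ((h σ).2.eventually (lt_mem_nhds hlt)).exists
    exact ⟨s, Part.mem_some_iff.2 ((hts s).2 hs).symm, fun _ => ⟨⟩⟩

theorem sum_toNat_eq_ceil {f : ℕ → Bool} {x : ℝ} {T : ℕ} (hx : x ≤ T)
    (hf : ∀ k, f k = true ↔ (k : ℝ) < x) : ∑ k ∈ Finset.range T, (f k).toNat = ⌈x⌉₊ := by
  have hcard : ∑ k ∈ Finset.range T, (f k).toNat = ((Finset.range T).filter (f · = true)).card := by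
    rw [Finset.card_filter]
    exact Finset.sum_congr rfl fun k _ => by cases f k <;> rfl
  have hfilter : (Finset.range T).filter (f · = true) = Finset.range ⌈x⌉₊ := by
    ext k
    simp only [Finset.mem_filter, Finset.mem_range, hf, Nat.lt_ceil, and_iff_right_iff_imp]
    intro hk
    exact_mod_cast hk.trans_le hx
  rw [hcard, hfilter, Finset.card_range]

/-- The naturals below `x` number `⌈x⌉₊`, so counting the lower cut rounds up. Values of `δ` are at
most 1, so the range of `k` in `approx` cuts nothing off. -/
theorem exists_approx_eq {δ : List Bool → ℝ} (hδ : IsSemimeasure δ) (hce : IsLeftCE δ) (L : ℕ) :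
    ∃ e, (∀ σ, 2 ^ (L * σ.length) * δ σ ≤ approx L e σ) ∧
      ∀ σ, (approx L e σ : ℝ) < 2 ^ (L * σ.length) * δ σ + 1 := by
  obtain ⟨e, he⟩ := exists_halts_iff_lt hce L
  have heq : ∀ σ, approx L e σ = ⌈2 ^ (L * σ.length) * δ σ⌉₊ := fun σ =>
    sum_toNat_eq_ceil (by
      push_cast
      exact mul_le_of_le_one_right (by positivity) (hδ.mem_Icc σ).2) (he σ)
  refine ⟨e, fun σ => ?_, fun σ => ?_⟩
  · rw [heq]
    exact Nat.le_ceil _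
  · rw [heq]
    exact Nat.ceil_lt_add_one (mul_nonneg (by positivity) (hδ.mem_Icc σ).1)

/-! ### Boundedness excludes success, and the conclusion -/

theorem not_succeeds_of_eventually_le {M : List Bool → ℝ} {x : ℕ → Bool} {B : ℝ}
    (h : ∀ᶠ n in atTop, M (restrict x n) ≤ B) : ¬ Succeeds M x := by
  intro hs
  have : limsup (fun n => (M (restrict x n) : EReal)) atTop ≤ (B : EReal) :=
    limsup_le_of_le (h := h.mono fun n hn => EReal.coe_le_coe_iff.2 hn)
  rw [Succeeds] at hs
  rw [hs] at this
  exact absurd this (not_le.2 (EReal.coe_lt_top B))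

theorem exists_not_bernoulliRandom_not_succeeds (p : unitInterval)
    (hp : TuringReducible (toOracle emptyJump)
      (toOracle (binaryExpansion p))) :
    ∃ y : ℕ → Bool, y ∉ BernoulliRandom p ∧
      ∀ M : List Bool → ℝ, IsBlindSupermartingale p M →
        ¬ Succeeds M y := by
  have hpI := mem_Ioo_of_emptyJump_le hp
  -- The extra factor 2 in `2 / 2 ^ L ≤ min p (1 - p)` is the source of the geometric decay of the
  -- errors.
  obtain ⟨L, hL⟩ := exists_pow_lt_of_lt_one
    (show 0 < min (p : ℝ) (1 - p) / 2 from half_pos (lt_min hpI.1 (sub_pos.2 hpI.2)))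
    (show (2⁻¹ : ℝ) < 1 by norm_num)
  have hL' : 2 / 2 ^ L ≤ min (p : ℝ) (1 - p) := by
    rw [inv_pow] at hL
    rw [div_eq_mul_inv]
    linarith
  set c := approx L
  set P := bitsValue (binaryExpansion p)
  have hpath : ComputableIn {toOracle (binaryExpansion p)} (path c L P) :=
    computableIn_path (computableIn_approx (computableIn_of_toOracle hp) L)
      (computableIn_bitsValue (computableIn_toOracle _))
  refine ⟨fun n => nextBit c L P (path c L P n),
    not_mem_MLR_of_computableIn hpI (hpath.of_eq fun n => (restrict_nextBit_path n).symm), ?_⟩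
  rintro M ⟨δ, hδ, hce, hM⟩
  obtain ⟨e, hle, hlt⟩ := exists_approx_eq hδ hce L
  obtain ⟨B, hB⟩ := exists_total_path_le hpI (hL'.trans (min_le_left _ _))
    (hL'.trans (min_le_right _ _)) (approx_le L) (bitsValue_binaryExpansion hpI.2)
  refine not_succeeds_of_eventually_le (B := 2 ^ (L * e) * B) ?_
  filter_upwards [eventually_gt_atTop e] with n hn
  rw [restrict_nextBit_path, hM]
  refine (div_cylinder_le_total hδ hle hlt hpI (by rwa [length_path])).trans ?_
  rw [length_path]
  exact mul_le_mul_of_nonneg_left (hB n) (by positivity)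

end BlindBernoulli

theorem mainTheorem10 (p : unitInterval)
    (hp : TuringReducible (BlindBernoulli.toOracle BlindBernoulli.emptyJump)
      (BlindBernoulli.toOracle (BlindBernoulli.binaryExpansion p))) :
    ∃ y : ℕ → Bool, y ∉ BlindBernoulli.BernoulliRandom p ∧
      ∀ M : List Bool → ℝ, BlindBernoulli.IsBlindSupermartingale p M →
        ¬ BlindBernoulli.Succeeds M y :=
  BlindBernoulli.exists_not_bernoulliRandom_not_succeeds p hp
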